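/- **Theorem.** Let $K=\{z\in\mathbb C : |\operatorname{Re}z|+|\operatorname{Im}z|\le 1\}$ (the diamond). Define $t:\mathbb C\to\mathbb C$ by $t(0)=0$ and, for $z\neq0$ and with $\arg z\in(-\pi,\pi]$, $$t(z)=\begin{cases} z-1 & -\pi/4\le\arg z<\pi/4,\\ z-i & \pi/4\le\arg z<3\pi/4,\\ z+1 & 3\pi/4\le\arg z\ \text{ or }\ \arg z<-3\pi/4,\\ z+i & -3\pi/4\le\arg z<-\pi/4.\end{cases}$$ The choice function of the diamond algorithm is $\lfloor z\rceil=0$ for $z\in K$ and $\lfloor z\rceil=z-t^{n(z)}(z)$ for $z\notin K$, where $n(z)$ is the least $n$ with $t^n(z)\in K$. On $\overline{\mathbb C}=\mathbb C\cup\{\infty\}$ let $Sw=-1/w$ and, for a Gaussian integer $a$, $T^aw=w+a$. The natural extension of the Gauss map is $$\hat G(z,w)=(T^{-a}Sz,\;T^{-a}Sw),\qquad a=\lfloor Sz\rceil,$$ for $z\in\mathbb C\setminus\{0\}$ and $w\in\overline{\mathbb C}$ (its values on the null set $z=0$ are immaterial). Define $$\begin{aligned} K_1&=\{z\in K: |z-\tfrac{-1-i}2|\le\tfrac1{\sqrt2},\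 |z-\tfrac{-1+i}2|\le\tfrac1{\sqrt2}\},\\ K_2&=\{z\in K: |z-\tfrac{-1-i}2|\ge\tfrac1{\sqrt2},\ 0\le\operatorname{Im}z\le-\operatorname{Re}z\},\\ K_3&=\{z\in K: |z-\tfrac{1+i}2|\ge\tfrac1{\sqrt2},\ -\operatorname{Im}z\le\operatorname{Re}z\le0\},\\ K_j&=-i\,K_{j-3}\quad(4\le j\le12), \end{aligned}$$ and, writing $B(c)$ for the open unit disk with center $c$, $$\begin{aligned} L_1&=\overline{\mathbb C}\setminus\big(B(i)\cup B(0)\cup B(-i)\cup\{w\in\mathbb C:\operatorname{Re}w<-\tfrac12\}\big),\\ L_2&=\overline{\mathbb C}\setminus\big(B(i)\cup B(0)\cup\{w\in\mathbb C:\operatorname{Re}w<-\tfrac12\}\big),\\ L_3&=\overline{\mathbb C}\setminus\big(B(-1)\cup B(0)\cup\{w\in\mathbb C:\operatorname{Im}w>\tfrac12\}\big),\\ L_j&=-i\,L_{j-3}\quad(4\le j\le12). \end{aligned}$$ Then $\hat G$ is bijective almost everywhere on $\Omega=\bigcup_{j=1}^{12}K_j\times L_j$: there are sets $A,B\subseteq\Omega$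 such that $\Omega\setminus A$ and $\Omega\setminus B$ are null sets and $\hat G$ restricts to a bijection from $A$ onto $B$. Null sets are those of the Lebesgue measure of $\mathbb C\times\mathbb C$, regarded as a measure on $\mathbb C\times\overline{\mathbb C}$ for which $\mathbb C\times\{\infty\}$ is null. -/

import Mathlib

open Set MeasureTheory

noncomputable section

namespace DiamondCF

/-! ### The diamond choice function -/

/-- One step of the reduction: subtract the unit `1, i, -1, -i` in whose quadrant (centred on the
coordinate half-axes) `z` lies; `arg` takes values in `(-π, π]`. -/
def unitStep (z : ℂ) : ℂ :=
  if z = 0 then 0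
  else if -(Real.pi / 4) ≤ z.arg ∧ z.arg < Real.pi / 4 then z - 1
  else if Real.pi / 4 ≤ z.arg ∧ z.arg < 3 * Real.pi / 4 then z - Complex.I
  else if 3 * Real.pi / 4 ≤ z.arg ∨ z.arg < -(3 * Real.pi / 4) then z + 1
  else z + Complex.I

/-- The number of reduction steps needed to reach `X` from `z`. -/
def stepCount (X : Set ℂ) (z : ℂ) : ℕ := sInf {n : ℕ | unitStep^[n] z ∈ X}

open Classical in
/-- The choice function `[z]` constructed from a set `X`: it is `0` on `X`, and otherwise the total
amount subtracted from `z` until `X` is first reached. -/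
def choiceOf (X : Set ℂ) (z : ℂ) : ℂ :=
  if z ∈ X then 0 else z - unitStep^[stepCount X z] z

/-- The diamond with corners `±1` and `±i`. -/
def diamond : Set ℂ := {z | |z.re| + |z.im| ≤ 1}

/-- The choice function of the diamond algorithm. -/
def diamondChoice (z : ℂ) : ℂ := choiceOf diamond z

/-! ### The natural extension of the Gauss map -/

/-- `S w = -1 / w` on the Riemann sphere, with `S 0 = ∞` and `S ∞ = 0`. -/
def sphereS : OnePoint ℂ → OnePoint ℂ
  | none => ((0 : ℂ) : OnePoint ℂ)
  | some w => if w = 0 then OnePoint.infty else ((-1 / w : ℂ) : OnePoint ℂ)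

/-- The translation `T^a w = w + a` on the Riemann sphere, fixing `∞`. -/
def sphereT (a : ℂ) : OnePoint ℂ → OnePoint ℂ := OnePoint.map (fun w => w + a)

/-- The natural extension `(z, w) ↦ (T^{-a} S z, T^{-a} S w)` with `a = [S z]`, of the Gauss map of
the diamond algorithm. On the null set `z = 0`, the conventions `-1 / 0 = 0` and `[0] = 0` give the
first coordinate the value `0`, in accordance with `G 0 = 0`. -/
def natExt (p : ℂ × OnePoint ℂ) : ℂ × OnePoint ℂ :=
  (-1 / p.1 - diamondChoice (-1 / p.1), sphereT (-diamondChoice (-1 / p.1)) (sphereS p.2))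

/-! ### The sets `K_i` and `L_i`, `1 ≤ i ≤ 12` -/

/-- The pieces `K_1, …, K_12` of the diamond (only the indices `1, …, 12` are used). -/
def K : ℕ → Set ℂ
  | 0 => ∅
  | 1 => {z | z ∈ diamond ∧ ‖z - (-1 - Complex.I) / 2‖ ≤ 1 / √2 ∧
      ‖z - (-1 + Complex.I) / 2‖ ≤ 1 / √2}
  | 2 => {z | z ∈ diamond ∧ 1 / √2 ≤ ‖z - (-1 - Complex.I) / 2‖ ∧
      0 ≤ z.im ∧ z.im ≤ -z.re}
  | 3 => {z | z ∈ diamond ∧ 1 / √2 ≤ ‖z - (1 + Complex.I) / 2‖ ∧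
      -z.im ≤ z.re ∧ z.re ≤ 0}
  | i + 4 => (fun z => -Complex.I * z) '' K (i + 1)

/-- The closed subsets `L_1, …, L_12` of the Riemann sphere (only the indices `1, …, 12` are
used). -/
def L : ℕ → Set (OnePoint ℂ)
  | 0 => ∅
  | 1 => univ \ ((↑) '' (Metric.ball Complex.I 1 ∪ Metric.ball (0 : ℂ) 1 ∪
      Metric.ball (-Complex.I) 1 ∪ {w : ℂ | w.re < -1 / 2}))
  | 2 => univ \ ((↑) '' (Metric.ball Complex.I 1 ∪ Metric.ball (0 : ℂ) 1 ∪
      {w : ℂ | w.re < -1 / 2}))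
  | 3 => univ \ ((↑) '' (Metric.ball (-1 : ℂ) 1 ∪ Metric.ball (0 : ℂ) 1 ∪
      {w : ℂ | 1 / 2 < w.im}))
  | i + 4 => OnePoint.map (fun w => -Complex.I * w) '' L (i + 1)

/-- The set `⋃ K_i × L_i`, the union being over `1 ≤ i ≤ 12`. -/
def Omega : Set (ℂ × OnePoint ℂ) := ⋃ i ∈ Finset.Icc 1 12, K i ×ˢ L i

/-! ### Lebesgue measure and bijectivity almost everywhere -/

instance : MeasurableSpace (OnePoint ℂ) := borel (OnePoint ℂ)

instance : BorelSpace (OnePoint ℂ) := ⟨rfl⟩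

/-- The inclusion of `ℂ × ℂ` into `ℂ × (ℂ ∪ {∞})`. -/
def incl (p : ℂ × ℂ) : ℂ × OnePoint ℂ := (p.1, (p.2 : OnePoint ℂ))

/-- Lebesgue measure of `ℂ × ℂ`, regarded as a measure on `ℂ × (ℂ ∪ {∞})` for which
`ℂ × {∞}` is a null set. -/
def lebesgue : Measure (ℂ × OnePoint ℂ) := (volume : Measure (ℂ × ℂ)).map incl

theorem measurableEmbedding_incl : MeasurableEmbedding incl :=
  MeasurableEmbedding.id.prodMap (OnePoint.isOpenEmbedding_coe (X := ℂ)).measurableEmbedding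

/-- The measure is the Lebesgue measure of the part in `ℂ × ℂ`, for every set. -/
theorem lebesgue_apply (s : Set (ℂ × OnePoint ℂ)) : lebesgue s = volume (incl ⁻¹' s) :=
  measurableEmbedding_incl.map_apply _ s

/-- `f` is bijective almost everywhere on `s`: after removing null sets from `s` as the domain and
from `s` as the target, `f` is a bijection of the one remaining set onto the other. -/
def BijectiveAEOn {α : Type*} [MeasurableSpace α] (μ : Measure α) (f : α → α) (s : Set α) : Prop :=
  ∃ A B : Set α, A ⊆ s ∧ B ⊆ s ∧ μ (s \ A) = 0 ∧ μ (s \ B) = 0 ∧ BijOn f A B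

end DiamondCF

end

/-! The choice function is an iterated subtraction of units, so `natExt` is one inversion followed
by unit translations. Extend the fibred domain from the diamond to the whole plane (`Fiber`, `Dom`),
and let an elementary move be `invExt` over the diamond and `stepExt` outside it. Then `natExt` is
the first return map of this move to the diamond.

The core is `uniqueSource`: off all lines and circles with integer coefficients, a point lies in the
extended domain exactly when one of five candidate predecessors (one inversion, four translations)
is admissible, and two never are. Hence the move is a bijection of `Dom`. The symmetries of the
square reduce this to `0 < y < x`, where it is a finite comparison of half-planes and disks
(`uniqueSource_octant`).

A bijection induces a bijective first return map if returns are finite in both directions. Forwards,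
`|x| + |y|` falls by one per step. Backwards, the second coordinate, measured in the quadrant of the
first, rises by one per step but stays below the bound of `fiber_bound`, so an inversion must be met
(`exists_iterate_eq`).

Finally `incl_mem_omega_iff` identifies the generic part of `Omega` with the part of `Dom` over the
diamond; the non-generic points lie in a countable union of null sets. -/

noncomputable section

namespace DiamondCF

/-! ### Generic points and their invariance -/

/-- The point `(x, y)` lies on no circle or line with integer coefficients. -/
def Generic (x y : ℝ) : Prop :=
  ∀ a p q d : ℤ, a * (x ^ 2 + y ^ 2) + p * x + q * y + d = 0 → a = 0 ∧ p = 0 ∧ q = 0 ∧ d = 0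

theorem Generic.ne {x y : ℝ} (h : Generic x y) (a p q d : ℤ)
    (h0 : ¬ (a = 0 ∧ p = 0 ∧ q = 0 ∧ d = 0) := by decide) :
    a * (x ^ 2 + y ^ 2) + p * x + q * y + d ≠ 0 := fun e => h0 (h a p q d e)

theorem Generic.swap {x y : ℝ} (h : Generic x y) : Generic y x := by
  intro a p q d e
  have := h a q p d (by linarith)
  tauto

theorem Generic.neg_left {x y : ℝ} (h : Generic x y) : Generic (-x) y := by
  intro a p q d e
  have := h a (-p) q d (by push_cast; linarith)
  simpa using this

theorem Generic.neg_right {x y : ℝ} (h : Generic x y) : Generic x (-y) :=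
  h.swap.neg_left.swap

/-- Expanding the square leaves the leading coefficient `a` unchanged; once it vanishes, so do `p`
and `q`, and then `d`. -/
theorem Generic.add {x y : ℝ} (h : Generic x y) (b c : ℤ) : Generic (x + b) (y + c) := by
  intro a p q d e
  obtain ⟨rfl, h1, h2, h3⟩ := h a (2 * a * b + p) (2 * a * c + q)
    (a * (b ^ 2 + c ^ 2) + p * b + q * c + d) (by push_cast; linarith)
  simp at h1 h2
  subst h1 h2
  simpa using h3

theorem Generic.normSq_pos {x y : ℝ} (h : Generic x y) : 0 < x ^ 2 + y ^ 2 := by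
  have := h.ne 1 0 0 0
  have h' : x ^ 2 + y ^ 2 ≠ 0 := by simpa using this
  positivity

/-- Clearing denominators exchanges the leading and the constant coefficient. -/
theorem Generic.inv {x y : ℝ} (h : Generic x y) :
    Generic (x / (x ^ 2 + y ^ 2)) (y / (x ^ 2 + y ^ 2)) := by
  intro a p q d e
  have hn := h.normSq_pos
  have : (d : ℝ) * (x ^ 2 + y ^ 2) + p * x + q * y + a = 0 := by
    field_simp at e
    linarith
  have := h d p q a this
  tauto

theorem Generic.left_ne {x y : ℝ} (h : Generic x y) : x ≠ 0 := by simpa using h.ne 0 1 0 0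

theorem Generic.right_ne {x y : ℝ} (h : Generic x y) : y ≠ 0 := by simpa using h.ne 0 0 1 0

theorem Generic.abs_ne {x y : ℝ} (h : Generic x y) : |x| ≠ |y| := by
  intro e
  rcases abs_eq_abs.1 e with e | e
  · exact (h.ne 0 1 (-1) 0) (by norm_num; linarith)
  · exact (h.ne 0 1 1 0) (by norm_num; linarith)

theorem Generic.abs_add_abs_ne_one {x y : ℝ} (h : Generic x y) : |x| + |y| ≠ 1 := by
  intro e
  rcases abs_cases x with ⟨e1, -⟩ | ⟨e1, -⟩ <;> rcases abs_cases y with ⟨e2, -⟩ | ⟨e2, -⟩ <;>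
    rw [e1, e2] at e
  · exact (h.ne 0 1 1 (-1)) (by norm_num; linarith)
  · exact (h.ne 0 1 (-1) (-1)) (by norm_num; linarith)
  · exact (h.ne 0 (-1) 1 (-1)) (by norm_num; linarith)
  · exact (h.ne 0 (-1) (-1) (-1)) (by norm_num; linarith)

/-! ### The extended domain and its symmetries -/

/-- The domain of the natural extension, extended from the diamond to the plane, over the points
`(x, y)` of the octant `0 < y < x`. -/
def OctantFiber (x y u v : ℝ) : Prop :=
  u < 1 / 2 ∧
  (x + y < 1 → 1 < u ^ 2 + v ^ 2 ∧ 2 * v < u ^ 2 + v ^ 2 ∧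
    (x ^ 2 + y ^ 2 < x - y → -(2 * v) < u ^ 2 + v ^ 2)) ∧
  (1 < x + y → v < 1 / 2 ∧ 2 * u < u ^ 2 + v ^ 2 ∧
    (1 < x - y → -(1 / 2) < v) ∧ (x ^ 2 + y ^ 2 < x + y → 1 < u ^ 2 + v ^ 2))

/-- A sign, `1` or `-1`. -/
def sgn (x : ℝ) : ℝ := if 0 < x then 1 else -1

/-- The extension of `OctantFiber` to all octants, by symmetry. -/
def Fiber (x y u v : ℝ) : Prop :=
  if |y| < |x| then OctantFiber |x| |y| (sgn x * u) (sgn y * v)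
  else OctantFiber |y| |x| (sgn y * v) (sgn x * u)

theorem sgn_of_pos {x : ℝ} (h : 0 < x) : sgn x = 1 := if_pos h

theorem sgn_of_neg {x : ℝ} (h : x < 0) : sgn x = -1 := if_neg h.not_gt

theorem sgn_neg {x : ℝ} (h : x ≠ 0) : sgn (-x) = -sgn x := by
  rcases h.lt_or_gt with h | h
  · rw [sgn_of_neg h, sgn_of_pos (by linarith)]; norm_num
  · rw [sgn_of_pos h, sgn_of_neg (by linarith)]

theorem fiber_octant {x y u v : ℝ} (hy : 0 < y) (hx : y < x) :
    Fiber x y u v ↔ OctantFiber x y u v := by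
  have hx0 : 0 < x := hy.trans hx
  simp [Fiber, abs_of_pos, hy, hx0, hx, sgn_of_pos]

theorem fiber_neg {x y u v : ℝ} (h : x ≠ 0) : Fiber (-x) y (-u) v ↔ Fiber x y u v := by
  simp [Fiber, sgn_neg h]

theorem fiber_swap {x y u v : ℝ} (h : |x| ≠ |y|) : Fiber y x v u ↔ Fiber x y u v := by
  unfold Fiber
  rcases h.lt_or_gt with h | h
  · rw [if_pos h, if_neg h.not_gt]
  · rw [if_neg h.not_gt, if_pos h]

theorem fiber_neg_right {x y u v : ℝ} (h : y ≠ 0) : Fiber x (-y) u (-v) ↔ Fiber x y u v := by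
  simp [Fiber, sgn_neg h]

/-! ### Sources of a point and their symmetries -/

/-- `(x, y, u, v)` is reached by inversion from a point of the extended domain. -/
def InvSource (x y u v : ℝ) : Prop :=
  |x| + |y| < x ^ 2 + y ^ 2 ∧ Fiber (x / (x ^ 2 + y ^ 2)) (y / (x ^ 2 + y ^ 2))
    (u / (u ^ 2 + v ^ 2)) (v / (u ^ 2 + v ^ 2))

/-- `(x, y, u, v)` is reached from a point of the extended domain by subtracting `(a, b)`. -/
def StepSource (a b x y u v : ℝ) : Prop :=
  1 < |x + a| + |y + b| ∧ |a * (y + b) - b * (x + a)| < a * (x + a) + b * (y + b) ∧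
    Fiber (x + a) (y + b) (u + a) (v + b)

/-- A point lies in the extended domain if and only if it has a source, and it never has two. -/
def UniqueSource (x y u v : ℝ) : Prop :=
  (Fiber x y u v ↔ InvSource x y u v ∨ StepSource 1 0 x y u v ∨ StepSource (-1) 0 x y u v ∨
    StepSource 0 1 x y u v ∨ StepSource 0 (-1) x y u v) ∧
  ¬ (InvSource x y u v ∧ StepSource 1 0 x y u v) ∧
  ¬ (InvSource x y u v ∧ StepSource (-1) 0 x y u v) ∧
  ¬ (InvSource x y u v ∧ StepSource 0 1 x y u v) ∧
  ¬ (InvSource x y u v ∧ StepSource 0 (-1) x y u v) ∧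
  ¬ (StepSource 1 0 x y u v ∧ StepSource (-1) 0 x y u v) ∧
  ¬ (StepSource 1 0 x y u v ∧ StepSource 0 1 x y u v) ∧
  ¬ (StepSource 1 0 x y u v ∧ StepSource 0 (-1) x y u v) ∧
  ¬ (StepSource (-1) 0 x y u v ∧ StepSource 0 1 x y u v) ∧
  ¬ (StepSource (-1) 0 x y u v ∧ StepSource 0 (-1) x y u v) ∧
  ¬ (StepSource 0 1 x y u v ∧ StepSource 0 (-1) x y u v)

theorem invSource_neg {x y u v : ℝ} (h : Generic x y) :
    InvSource (-x) y (-u) v ↔ InvSource x y u v := by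
  unfold InvSource
  simp only [neg_sq, abs_neg, neg_div]
  rw [fiber_neg h.inv.left_ne]

theorem invSource_swap {x y u v : ℝ} (h : Generic x y) :
    InvSource y x v u ↔ InvSource x y u v := by
  unfold InvSource
  rw [add_comm (y ^ 2), add_comm (v ^ 2), add_comm |y|, fiber_swap h.inv.abs_ne]

theorem stepSource_neg {a b : ℤ} {x y u v : ℝ} (h : Generic x y) :
    StepSource (-a) b (-x) y (-u) v ↔ StepSource a b x y u v := by
  unfold StepSource
  rw [← neg_add, ← neg_add, fiber_neg (h.add a b).left_ne, abs_neg,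
    ← abs_neg (-(a : ℝ) * (y + b) - b * -(x + a))]
  ring_nf

theorem stepSource_swap {a b : ℤ} {x y u v : ℝ} (h : Generic x y) :
    StepSource b a y x v u ↔ StepSource a b x y u v := by
  unfold StepSource
  rw [fiber_swap (h.add a b).abs_ne, add_comm |y + b|, ← abs_neg ((b : ℝ) * (x + a) - _),
    neg_sub, add_comm ((b : ℝ) * _)]

theorem uniqueSource_neg {x y u v : ℝ} (h : Generic x y) (H : UniqueSource x y u v) :
    UniqueSource (-x) y (-u) v := by
  have h1 := stepSource_neg (a := 1) (b := 0) (u := u) (v := v) h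
  have h2 := stepSource_neg (a := -1) (b := 0) (u := u) (v := v) h
  have h3 := stepSource_neg (a := 0) (b := 1) (u := u) (v := v) h
  have h4 := stepSource_neg (a := 0) (b := -1) (u := u) (v := v) h
  push_cast at h1 h2 h3 h4
  rw [neg_zero] at h3 h4
  rw [neg_neg] at h2
  unfold UniqueSource at *
  rw [fiber_neg h.left_ne, invSource_neg h, h1, h2, h3, h4]
  obtain ⟨H0, i1, i2, i3, i4, s12, s13, s14, s23, s24, s34⟩ := H
  exact ⟨H0.trans (or_congr_right or_left_comm), i2, i1, i3, i4, fun h => s12 h.symm, s23, s24, s13, s14, s34⟩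

theorem uniqueSource_swap {x y u v : ℝ} (h : Generic x y) (H : UniqueSource x y u v) :
    UniqueSource y x v u := by
  have h1 := stepSource_swap (a := 1) (b := 0) (u := u) (v := v) h
  have h2 := stepSource_swap (a := -1) (b := 0) (u := u) (v := v) h
  have h3 := stepSource_swap (a := 0) (b := 1) (u := u) (v := v) h
  have h4 := stepSource_swap (a := 0) (b := -1) (u := u) (v := v) h
  push_cast at h1 h2 h3 h4
  unfold UniqueSource at *
  rw [fiber_swap h.abs_ne, invSource_swap h, h1, h2, h3, h4]
  obtain ⟨H0, i1, i2, i3, i4, s12, s13, s14, s23, s24, s34⟩ := H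
  exact ⟨H0.trans (or_congr_right (by rw [← or_assoc, or_comm, or_assoc])), i3, i4, i1, i2, s34, fun h => s13 h.symm, fun h => s23 h.symm,
    fun h => s14 h.symm, fun h => s24 h.symm, s12⟩

/-! ### Uniqueness of the source, octant by octant -/

/-- Inversion preserves the octant, exchanges the two sides of the unit circle, and exchanges
circles through the origin with lines. The source lies in the diamond, so only the first branch of
`OctantFiber` is active there. -/
theorem invSource_octant {x y u v : ℝ} (hy : 0 < y) (hx : y < x) (hw : 0 < u ^ 2 + v ^ 2) :
    InvSource x y u v ↔ x + y < x ^ 2 + y ^ 2 ∧ 2 * u < u ^ 2 + v ^ 2 ∧ u ^ 2 + v ^ 2 < 1 ∧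
      v < 1 / 2 ∧ (1 < x - y → -(1 / 2) < v) := by
  have hx0 : 0 < x := hy.trans hx
  have hn : 0 < x ^ 2 + y ^ 2 := by positivity
  unfold InvSource
  rw [fiber_octant (by positivity) (by gcongr), abs_of_pos hy, abs_of_pos hx0]
  refine and_congr_right fun h => ?_
  have e1 : ∀ a b : ℝ, 0 < a ^ 2 + b ^ 2 →
      (a / (a ^ 2 + b ^ 2)) ^ 2 + (b / (a ^ 2 + b ^ 2)) ^ 2 = 1 / (a ^ 2 + b ^ 2) := by
    intro a b hab
    field_simp
  unfold OctantFiber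
  rw [e1 x y hn, e1 u v hw, ← add_div, ← sub_div, div_lt_one hn, lt_div_iff₀ hw, one_lt_div hn,
    div_lt_div_iff_of_pos_right hn, ← mul_div_assoc, ← neg_div, div_lt_div_iff_of_pos_right hw,
    div_lt_div_iff_of_pos_right hw, div_lt_iff₀ hw]
  constructor
  · rintro ⟨h1, h2, -⟩
    obtain ⟨h3, h4, h5⟩ := h2 h
    refine ⟨by linarith, by linarith, by linarith, fun h6 => by linarith [h5 h6]⟩
  · rintro ⟨h1, h2, h3, h4⟩
    refine ⟨by linarith, fun _ => ⟨by linarith, by linarith, fun h6 => by linarith [h4 h6]⟩,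
      fun h6 => by linarith⟩

theorem stepSource_one_zero {x y u v : ℝ} (hy : 0 < y) (hx : y < x) :
    StepSource 1 0 x y u v ↔ u < -(1 / 2) ∧ -(1 / 2) < v ∧ v < 1 / 2 ∧ 1 < u ^ 2 + v ^ 2 := by
  have hx0 : 0 < x := hy.trans hx
  unfold StepSource
  simp only [add_zero, one_mul, zero_mul, sub_zero]
  rw [fiber_octant hy (by linarith), abs_of_pos hy, abs_of_pos (by linarith)]
  unfold OctantFiber
  constructor
  · rintro ⟨-, -, h1, -, h2⟩
    obtain ⟨h3, h4, h5, -⟩ := h2 (by linarith)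
    exact ⟨by linarith, h5 (by linarith), h3, by linarith⟩
  · rintro ⟨h1, h2, h3, h4⟩
    refine ⟨by linarith, by linarith, by linarith, fun h => by linarith,
      fun h => ⟨h3, by linarith, fun _ => h2, fun h' => ?_⟩⟩
    -- `h'` is contradictory: it simplifies to `x ^ 2 + y ^ 2 + x < y`, against `y < x`.
    nlinarith

theorem stepSource_neg_one_zero {x y u v : ℝ} (hy : 0 < y) (hx : y < x) :
    ¬ StepSource (-1) 0 x y u v := by
  rintro ⟨h1, h2, -⟩
  simp only [add_zero, zero_mul, sub_zero, abs_mul, abs_neg, abs_one, one_mul,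
    abs_of_pos hy] at h1 h2
  rw [abs_of_neg (by linarith)] at h1
  linarith

/-- When the source `z + i` lies in the sector of `i`, the swap of coordinates brings it into the
octant, beyond the line `x + y = 1`. -/
theorem stepSource_zero_one {x y u v : ℝ} (hy : 0 < y) (hx : y < x) :
    StepSource 0 1 x y u v ↔ x < y + 1 ∧ u < 1 / 2 ∧ v < -(1 / 2) ∧ 1 < u ^ 2 + v ^ 2 ∧
      (x ^ 2 + y ^ 2 < x - y → -(2 * v) < u ^ 2 + v ^ 2) := by
  have hx0 : 0 < x := hy.trans hx
  unfold StepSource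
  simp only [add_zero, one_mul, zero_mul, zero_sub, zero_add, abs_neg, abs_of_pos hx0]
  rw [abs_of_pos (show 0 < y + 1 by linarith)]
  by_cases h : x < y + 1
  · rw [← fiber_swap (by rw [abs_of_pos (show 0 < y + 1 by linarith), abs_of_pos hx0]; exact h.ne),
      fiber_octant hx0 h]
    unfold OctantFiber
    constructor
    · rintro ⟨-, -, h1, -, h2⟩
      obtain ⟨h3, h4, -, h6⟩ := h2 (by linarith)
      exact ⟨h, h3, by linarith, by linarith, fun h7 => by linarith [h6 (by linarith)]⟩
    · rintro ⟨-, h1, h2, h3, h4⟩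
      exact ⟨by linarith, h, by linarith, fun h => by linarith, fun _ => ⟨h1, by linarith,
        fun _ => by linarith, fun h7 => by linarith [h4 (by linarith)]⟩⟩
  · simp [h]

theorem stepSource_zero_neg_one {x y u v : ℝ} (hy : 0 < y) (hx : y < x) :
    StepSource 0 (-1) x y u v ↔ x + y < 1 ∧ u < 1 / 2 ∧ 1 / 2 < v ∧ 1 < u ^ 2 + v ^ 2 ∧
      2 * v < u ^ 2 + v ^ 2 := by
  have hx0 : 0 < x := hy.trans hx
  unfold StepSource
  have e1 : y + -1 = -(1 - y) := by ring
  have e2 : v + -1 = -(1 - v) := by ring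
  simp only [add_zero, zero_mul, zero_sub, zero_add, neg_mul, one_mul, neg_neg, e1, e2,
    abs_of_pos hx0, abs_neg]
  by_cases h : x + y < 1
  · have h0 : 0 < 1 - y := by linarith
    rw [fiber_neg_right h0.ne', ← fiber_swap (by
      rw [abs_of_pos h0, abs_of_pos hx0]; linarith), fiber_octant hx0 (by linarith), abs_of_pos h0]
    unfold OctantFiber
    constructor
    · rintro ⟨-, -, h1, -, h2⟩
      obtain ⟨h3, h4, -, h6⟩ := h2 (by linarith)
      -- The premise of `h6` amounts to `x ^ 2 + y ^ 2 < x + y`, which holds since `x` and `y` are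
      -- positive with sum below one.
      exact ⟨h, h3, by linarith, by linarith, by nlinarith [h6 (by nlinarith)]⟩
    · rintro ⟨-, h1, h2, h3, h4⟩
      exact ⟨by linarith, by linarith, by linarith, fun h => by linarith, fun _ => ⟨h1, by linarith,
        fun _ => by linarith, fun h7 => by linarith⟩⟩
  · have : ¬ x < 1 - y := by linarith
    simp [h, this]


theorem uniqueSource_octant {x y u v : ℝ} (hz : Generic x y) (hw : Generic u v)
    (hy : 0 < y) (hx : y < x) : UniqueSource x y u v := by
  have hx0 : 0 < x := hy.trans hx
  have hN := hw.normSq_pos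
  unfold UniqueSource
  rw [invSource_octant hy hx hN, stepSource_one_zero hy hx,
    iff_false_intro (stepSource_neg_one_zero hy hx),
    stepSource_zero_one hy hx, stepSource_zero_neg_one hy hx, fiber_octant hy hx]
  unfold OctantFiber
  have w1 : u ^ 2 + v ^ 2 ≠ 1 := fun e => (hw.ne 1 0 0 (-1)) (by norm_num; linarith)
  have w2 : v ≠ 1 / 2 := fun e => (hw.ne 0 0 2 (-1)) (by norm_num; linarith)
  have w3 : v ≠ -(1 / 2) := fun e => (hw.ne 0 0 2 1) (by norm_num; linarith)
  have z1 : x + y ≠ 1 := fun e => (hz.ne 0 1 1 (-1)) (by norm_num; linarith)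
  have z2 : x - y ≠ 1 := fun e => (hz.ne 0 1 (-1) (-1)) (by norm_num; linarith)
  have z3 : x ^ 2 + y ^ 2 ≠ x + y := fun e => (hz.ne 1 (-1) (-1) 0) (by norm_num; linarith)
  refine ⟨?_, ?_, ?_, ?_, ?_, ?_, ?_, ?_, ?_, ?_, ?_⟩
  · rcases z1.lt_or_gt with h1 | h1
    · have h2 : x ^ 2 + y ^ 2 < x + y := by nlinarith
      have h3 : ¬ 1 < x + y := h1.not_gt
      have h4 : x < y + 1 := by linarith
      have h5 : ¬ x + y < x ^ 2 + y ^ 2 := h2.not_gt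
      simp only [h1, h3, h4, h5, false_and, true_and, false_or, forall_const,
        false_imp_iff, and_true]
      constructor
      · rintro ⟨a1, a2, a3, a4⟩
        -- Inside the diamond there is no inversion source; the bands cut out by `v = ±1/2` select
        -- the translation.
        rcases w2.lt_or_gt with b | b
        · rcases w3.lt_or_gt with b' | b'
          · exact Or.inr (Or.inl ⟨a1, b', a2, a4⟩)
          -- In the middle band `|w| > 1` forces `u ^ 2 > 3/4`, hence `u < -1/2` because `u < 1/2`.
          · exact Or.inl ⟨by nlinarith, b', b, a2⟩
        · exact Or.inr (Or.inr ⟨a1, b, a2, a3⟩)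
      · rintro (⟨a1, a2, a3, a4⟩ | ⟨a1, a2, a3, a4⟩ | ⟨a1, a2, a3, a4⟩)
        · exact ⟨by linarith, a4, by linarith, fun _ => by linarith⟩
        · exact ⟨a1, a3, by linarith, a4⟩
        · exact ⟨a1, a3, a4, fun _ => by linarith⟩
    · have h3 : ¬ x + y < 1 := h1.not_gt
      simp only [h1, h3, false_and, false_imp_iff, true_and, or_false, false_or, forall_const]
      constructor
      · rintro ⟨a1, a2, a3, a4, a5⟩
        -- Outside the diamond the unit circle separates inversion from translation, and `v = -1/2`
        -- separates the two possible translations.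
        by_cases b1 : v < -(1 / 2)
        · have b2 : x < y + 1 := by
            by_contra hb
            have := a4 (lt_of_le_of_ne (by linarith) z2.symm)
            linarith
          rcases w1.lt_or_gt with b3 | b3
          · refine Or.inl ⟨?_, a3, b3, a2, fun h => by linarith⟩
            by_contra hb
            have := a5 (lt_of_le_of_ne (by linarith) z3)
            linarith
          · exact Or.inr (Or.inr ⟨b2, a1, b1, b3, fun h => by nlinarith⟩)
        · have b1' : -(1 / 2) < v := lt_of_le_of_ne (by linarith) w3.symm
          rcases w1.lt_or_gt with b3 | b3
          · refine Or.inl ⟨?_, a3, b3, a2, fun h => b1'⟩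
            by_contra hb
            have := a5 (lt_of_le_of_ne (by linarith) z3)
            linarith
          · exact Or.inr (Or.inl ⟨by nlinarith, b1', a2, b3⟩)
      · rintro (⟨a1, a2, a3, a4, a5⟩ | ⟨a1, a2, a3, a4⟩ | ⟨a1, a2, a3, a4, a5⟩)
        · exact ⟨by linarith, a4, a2, a5, fun h => by linarith⟩
        · exact ⟨by linarith, a3, by linarith, fun _ => a2, fun _ => a4⟩
        · exact ⟨a2, by linarith, by linarith, fun h => by linarith, fun _ => a4⟩
  -- Inversion needs `|w| < 1`, translations need `|w| > 1`, and the three translations occupy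
  -- disjoint bands of `v`.
  · rintro ⟨⟨-, -, h1, -⟩, -, -, -, h2⟩; linarith
  · exact And.right
  · rintro ⟨⟨-, -, h1, -⟩, -, -, -, h2, -⟩; linarith
  · rintro ⟨⟨-, -, h1, -⟩, -, -, -, h2, -⟩; linarith
  · exact And.right
  · rintro ⟨⟨-, h1, -⟩, -, -, h2, -⟩; linarith
  · rintro ⟨⟨-, -, h1, -⟩, -, -, h2, -⟩; linarith
  · exact And.left
  · exact And.left
  · rintro ⟨⟨-, -, h1, -⟩, -, -, h2, -⟩; linarith

theorem uniqueSource {x y u v : ℝ} (hz : Generic x y) (hw : Generic u v) :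
    UniqueSource x y u v := by
  have key : ∀ {x y u v : ℝ}, Generic x y → Generic u v → 0 < x → 0 < y →
      UniqueSource x y u v := by
    intro x y u v hz hw hx hy
    have hne := hz.abs_ne
    rw [abs_of_pos hx, abs_of_pos hy] at hne
    rcases hne.lt_or_gt with h | h
    · exact uniqueSource_swap hz.swap (uniqueSource_octant hz.swap hw.swap hx h)
    · exact uniqueSource_octant hz hw hy h
  have key' : ∀ {x y u v : ℝ}, Generic x y → Generic u v → 0 < y → UniqueSource x y u v := by
    intro x y u v hz hw hy
    rcases hz.left_ne.lt_or_gt with h | h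
    · simpa using uniqueSource_neg hz.neg_left (key hz.neg_left hw.neg_left (by linarith) hy)
    · exact key hz hw h hy
  rcases hz.right_ne.lt_or_gt with h | h
  · have := uniqueSource_swap hz.neg_right (key' hz.neg_right hw.neg_right (by linarith))
    have := uniqueSource_neg hz.neg_right.swap this
    rw [neg_neg, neg_neg] at this
    exact uniqueSource_swap hz.swap this
  · exact key' hz hw h

/-! ### The elementary moves as maps of the extended domain -/

/-- The reduction step, acting on the second coordinate by the same translation. -/
def stepExt (p : ℂ × ℂ) : ℂ × ℂ := (unitStep p.1, p.2 - (p.1 - unitStep p.1))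

/-- The inversion `S` on both coordinates. -/
def invExt (p : ℂ × ℂ) : ℂ × ℂ := (-1 / p.1, -1 / p.2)

/-- Both coordinates are generic. -/
def GenericPair (p : ℂ × ℂ) : Prop := Generic p.1.re p.1.im ∧ Generic p.2.re p.2.im

/-- The generic part of the domain of the natural extension, extended to the plane. -/
def Dom : Set (ℂ × ℂ) := {p | GenericPair p ∧ Fiber p.1.re p.1.im p.2.re p.2.im}

/-- `(a, b)` is one of the four units. -/
def IsUnitPair (a b : ℤ) : Prop :=
  a = 1 ∧ b = 0 ∨ a = -1 ∧ b = 0 ∨ a = 0 ∧ b = 1 ∨ a = 0 ∧ b = -1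

/-- The diagonals bound the sectors, so the sign of this cosine converts bounds on `arg` into
half-planes. -/
theorem arg_re_sub_im (z : ℂ) :
    z.re - z.im = ‖z‖ * √2 * Real.cos (z.arg + Real.pi / 4) := by
  rw [Real.cos_add, Real.cos_pi_div_four, Real.sin_pi_div_four]
  have h1 := Complex.norm_mul_cos_arg z
  have h2 := Complex.norm_mul_sin_arg z
  have h3 : √2 * √2 = 2 := Real.mul_self_sqrt (by norm_num)
  linear_combination (-(‖z‖ * Real.cos z.arg - ‖z‖ * Real.sin z.arg) / 2) * h3 - h1 + h2

theorem arg_re_add_im (z : ℂ) :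
    z.re + z.im = ‖z‖ * √2 * Real.cos (z.arg - Real.pi / 4) := by
  rw [Real.cos_sub, Real.cos_pi_div_four, Real.sin_pi_div_four]
  have h1 := Complex.norm_mul_cos_arg z
  have h2 := Complex.norm_mul_sin_arg z
  have h3 : √2 * √2 = 2 := Real.mul_self_sqrt (by norm_num)
  linear_combination (-(‖z‖ * Real.cos z.arg + ‖z‖ * Real.sin z.arg) / 2) * h3 - h1 - h2

/-- The sectors of the reduction step, in Cartesian coordinates. -/
theorem unitStep_cases {z : ℂ} (hz : z ≠ 0) :
    (unitStep z = z - 1 ∧ 0 ≤ z.re - z.im ∧ 0 ≤ z.re + z.im) ∨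
    (unitStep z = z - Complex.I ∧ z.re - z.im ≤ 0 ∧ 0 ≤ z.re + z.im) ∨
    (unitStep z = z + 1 ∧ z.re - z.im ≤ 0 ∧ z.re + z.im ≤ 0) ∨
    (unitStep z = z + Complex.I ∧ 0 ≤ z.re - z.im ∧ z.re + z.im ≤ 0) := by
  have hpos : 0 ≤ ‖z‖ * √2 := by positivity
  have h1 := z.neg_pi_lt_arg
  have h2 := z.arg_le_pi
  have hpi := Real.pi_pos
  rw [arg_re_sub_im, arg_re_add_im]
  unfold unitStep
  rw [if_neg hz]
  split_ifs with c1 c2 c3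
  · refine Or.inl ⟨rfl, mul_nonneg hpos (Real.cos_nonneg_of_mem_Icc ⟨?_, ?_⟩),
      mul_nonneg hpos (Real.cos_nonneg_of_mem_Icc ⟨?_, ?_⟩)⟩ <;> linarith [c1.1, c1.2]
  · refine Or.inr (Or.inl ⟨rfl, mul_nonpos_of_nonneg_of_nonpos hpos
      (Real.cos_nonpos_of_pi_div_two_le_of_le ?_ ?_),
      mul_nonneg hpos (Real.cos_nonneg_of_mem_Icc ⟨?_, ?_⟩)⟩) <;> linarith [c2.1, c2.2]
  · refine Or.inr (Or.inr (Or.inl ⟨rfl, mul_nonpos_of_nonneg_of_nonpos hpos ?_,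
      mul_nonpos_of_nonneg_of_nonpos hpos ?_⟩))
    · rcases c3 with c3 | c3
      · exact Real.cos_nonpos_of_pi_div_two_le_of_le (by linarith) (by linarith)
      · rw [← Real.cos_neg]
        exact Real.cos_nonpos_of_pi_div_two_le_of_le (by linarith) (by linarith)
    · rcases c3 with c3 | c3
      · exact Real.cos_nonpos_of_pi_div_two_le_of_le (by linarith) (by linarith)
      · rw [← Real.cos_neg]
        exact Real.cos_nonpos_of_pi_div_two_le_of_le (by linarith) (by linarith)
  · push Not at c1 c2 c3
    have c4 : z.arg < -(Real.pi / 4) := by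
      by_contra h
      have := c2 (c1 (by linarith))
      linarith
    refine Or.inr (Or.inr (Or.inr ⟨rfl,
      mul_nonneg hpos (Real.cos_nonneg_of_mem_Icc ⟨?_, ?_⟩),
      mul_nonpos_of_nonneg_of_nonpos hpos ?_⟩))
    · linarith
    · linarith
    · rw [← Real.cos_neg]
      exact Real.cos_nonpos_of_pi_div_two_le_of_le (by linarith) (by linarith)

/-- The strict inequality puts `z` in an open sector, which misses the other three closed ones; the
convention on the sector boundaries thus plays no role. -/
theorem unitStep_eq_sub {z : ℂ} {a b : ℤ} (hab : IsUnitPair a b)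
    (h : |a * z.im - b * z.re| < a * z.re + b * z.im) : unitStep z = z - (a + b * Complex.I) := by
  have hz : z ≠ 0 := by rintro rfl; simp at h
  obtain ⟨h1, h2⟩ := abs_lt.1 h
  rcases hab with ⟨rfl, rfl⟩ | ⟨rfl, rfl⟩ | ⟨rfl, rfl⟩ | ⟨rfl, rfl⟩ <;> push_cast at h1 h2 ⊢ <;>
  rcases unitStep_cases hz with ⟨e, h3, h4⟩ | ⟨e, h3, h4⟩ | ⟨e, h3, h4⟩ | ⟨e, h3, h4⟩ <;>
  first
  | (exfalso; linarith)
  | (rw [e]; ring)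

theorem exists_unitPair {z : ℂ} (h : |z.re| ≠ |z.im|) :
    ∃ a b : ℤ, IsUnitPair a b ∧ |a * z.im - b * z.re| < a * z.re + b * z.im := by
  rcases h.lt_or_gt with h | h
  · rcases le_total 0 z.im with h' | h'
    · refine ⟨0, 1, by simp [IsUnitPair], ?_⟩
      rw [abs_of_nonneg h'] at h
      simpa using h
    · refine ⟨0, -1, by simp [IsUnitPair], ?_⟩
      rw [abs_of_nonpos h'] at h
      simpa using h
  · rcases le_total 0 z.re with h' | h'
    · refine ⟨1, 0, by simp [IsUnitPair], ?_⟩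
      rw [abs_of_nonneg h'] at h
      simpa using h
    · refine ⟨-1, 0, by simp [IsUnitPair], ?_⟩
      rw [abs_of_nonpos h'] at h
      simpa using h

theorem mem_diamond {z : ℂ} : z ∈ diamond ↔ |z.re| + |z.im| ≤ 1 := Iff.rfl

theorem fiber_iff_source {x y u v : ℝ} (hz : Generic x y) (hw : Generic u v) :
    Fiber x y u v ↔ InvSource x y u v ∨ ∃ a b : ℤ, IsUnitPair a b ∧ StepSource a b x y u v := by
  rw [(uniqueSource hz hw).1]
  refine or_congr_right ⟨?_, ?_⟩
  · rintro (h | h | h | h)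
    · exact ⟨1, 0, by simp [IsUnitPair], by simpa using h⟩
    · exact ⟨-1, 0, by simp [IsUnitPair], by simpa using h⟩
    · exact ⟨0, 1, by simp [IsUnitPair], by simpa using h⟩
    · exact ⟨0, -1, by simp [IsUnitPair], by simpa using h⟩
  · rintro ⟨a, b, ⟨rfl, rfl⟩ | ⟨rfl, rfl⟩ | ⟨rfl, rfl⟩ | ⟨rfl, rfl⟩, h⟩ <;> push_cast at h
    · exact Or.inl h
    · exact Or.inr (Or.inl h)
    · exact Or.inr (Or.inr (Or.inl h))
    · exact Or.inr (Or.inr (Or.inr h))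

theorem not_invSource_and_stepSource {x y u v : ℝ} (hz : Generic x y) (hw : Generic u v)
    {a b : ℤ} (hab : IsUnitPair a b) : ¬ (InvSource x y u v ∧ StepSource a b x y u v) := by
  obtain ⟨-, i1, i2, i3, i4, -⟩ := uniqueSource hz hw
  rcases hab with ⟨rfl, rfl⟩ | ⟨rfl, rfl⟩ | ⟨rfl, rfl⟩ | ⟨rfl, rfl⟩ <;> push_cast
  · exact i1
  · exact i2
  · exact i3
  · exact i4

theorem stepSource_unique {x y u v : ℝ} (hz : Generic x y) (hw : Generic u v)
    {a b a' b' : ℤ} (hab : IsUnitPair a b) (hab' : IsUnitPair a' b')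
    (h : StepSource a b x y u v) (h' : StepSource a' b' x y u v) : a = a' ∧ b = b' := by
  obtain ⟨-, -, -, -, -, s12, s13, s14, s23, s24, s34⟩ := uniqueSource hz hw
  rcases hab with ⟨rfl, rfl⟩ | ⟨rfl, rfl⟩ | ⟨rfl, rfl⟩ | ⟨rfl, rfl⟩ <;>
  rcases hab' with ⟨rfl, rfl⟩ | ⟨rfl, rfl⟩ | ⟨rfl, rfl⟩ | ⟨rfl, rfl⟩ <;>
  push_cast at h h'
  · exact ⟨rfl, rfl⟩
  · exact (s12 ⟨h, h'⟩).elim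
  · exact (s13 ⟨h, h'⟩).elim
  · exact (s14 ⟨h, h'⟩).elim
  · exact (s12 ⟨h', h⟩).elim
  · exact ⟨rfl, rfl⟩
  · exact (s23 ⟨h, h'⟩).elim
  · exact (s24 ⟨h, h'⟩).elim
  · exact (s13 ⟨h', h⟩).elim
  · exact (s23 ⟨h', h⟩).elim
  · exact ⟨rfl, rfl⟩
  · exact (s34 ⟨h, h'⟩).elim
  · exact (s14 ⟨h', h⟩).elim
  · exact (s24 ⟨h', h⟩).elim
  · exact (s34 ⟨h', h⟩).elim
  · exact ⟨rfl, rfl⟩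

theorem neg_one_div_re (z : ℂ) : (-1 / z).re = -(z.re / (z.re ^ 2 + z.im ^ 2)) := by
  simp [Complex.normSq_apply, sq, neg_div]

theorem neg_one_div_im (z : ℂ) : (-1 / z).im = z.im / (z.re ^ 2 + z.im ^ 2) := by
  simp [Complex.normSq_apply, sq, neg_div]

theorem invExt_invExt {p : ℂ × ℂ} : invExt (invExt p) = p := by
  simp [invExt, neg_div, div_neg]

theorem GenericPair.invExt {p : ℂ × ℂ} (h : GenericPair p) : GenericPair (invExt p) := by
  unfold GenericPair DiamondCF.invExt
  rw [neg_one_div_re, neg_one_div_im, neg_one_div_re, neg_one_div_im]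
  exact ⟨h.1.inv.neg_left, h.2.inv.neg_left⟩

/-- `-1 / z` is the inversion in the unit circle, as used in `InvSource`, followed by the reflection
in the imaginary axis, under which everything is invariant. -/
theorem invSource_invExt {p : ℂ × ℂ} (h : GenericPair p) :
    InvSource (invExt p).1.re (invExt p).1.im (invExt p).2.re (invExt p).2.im ↔
      p.1 ∈ diamond ∧ Fiber p.1.re p.1.im p.2.re p.2.im := by
  have h1 := h.1.normSq_pos
  have h2 := h.2.normSq_pos
  have e : ∀ a b : ℝ, 0 < a ^ 2 + b ^ 2 →
      (a / (a ^ 2 + b ^ 2)) ^ 2 + (b / (a ^ 2 + b ^ 2)) ^ 2 = 1 / (a ^ 2 + b ^ 2) := by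
    intro a b hab
    field_simp
  have e' : ∀ a b c : ℝ, 0 < a ^ 2 + b ^ 2 → c / (a ^ 2 + b ^ 2) / (1 / (a ^ 2 + b ^ 2)) = c := by
    intro a b c hab
    field_simp
  simp only [invExt]
  rw [neg_one_div_re, neg_one_div_im, neg_one_div_re, neg_one_div_im, invSource_neg h.1.inv]
  unfold InvSource
  rw [e _ _ h1, e _ _ h2, e' _ _ _ h1, e' _ _ _ h1, e' _ _ _ h2, e' _ _ _ h2, abs_div, abs_div,
    abs_of_pos h1, ← add_div, div_lt_div_iff_of_pos_right h1, mem_diamond,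
    h.1.abs_add_abs_ne_one.le_iff_lt]

theorem invExt_mem_dom {p : ℂ × ℂ} (h : p ∈ Dom) (hK : p.1 ∈ diamond) : invExt p ∈ Dom :=
  ⟨h.1.invExt, (fiber_iff_source h.1.invExt.1 h.1.invExt.2).2
    (Or.inl ((invSource_invExt h.1).2 ⟨hK, h.2⟩))⟩

theorem invExt_notMem_diamond {p : ℂ × ℂ} (h : GenericPair p) (hK : p.1 ∈ diamond) :
    (invExt p).1 ∉ diamond := by
  have hn := h.1.normSq_pos
  have hx := abs_pos.2 h.1.left_ne
  have hy := abs_pos.2 h.1.right_ne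
  rw [mem_diamond] at hK
  simp only [invExt]
  rw [mem_diamond, neg_one_div_re, neg_one_div_im, abs_neg, abs_div, abs_div, abs_of_pos hn,
    ← add_div, div_le_one hn, ← sq_abs p.1.re, ← sq_abs p.1.im]
  nlinarith

theorem GenericPair.stepExt {p : ℂ × ℂ} (h : GenericPair p) : GenericPair (stepExt p) := by
  obtain ⟨a, b, hab, hs⟩ := exists_unitPair h.1.abs_ne
  unfold GenericPair DiamondCF.stepExt
  rw [unitStep_eq_sub hab hs]
  have h1 := h.1.add (-a) (-b)
  have h2 := h.2.add (-a) (-b)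
  push_cast at h1 h2
  constructor
  · simpa [sub_eq_add_neg] using h1
  · simpa [sub_eq_add_neg] using h2

/-- The target of a reduction step from `p` arises from `p` as a step source. -/
theorem exists_stepSource_stepExt {p : ℂ × ℂ} (h : p ∈ Dom) (hK : p.1 ∉ diamond) :
    ∃ a b : ℤ, IsUnitPair a b ∧
      p = (stepExt p).map (· + (a + b * Complex.I)) (· + (a + b * Complex.I)) ∧
      StepSource a b (stepExt p).1.re (stepExt p).1.im (stepExt p).2.re (stepExt p).2.im := by
  obtain ⟨a, b, hab, hs⟩ := exists_unitPair h.1.1.abs_ne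
  refine ⟨a, b, hab, ?_, ?_⟩
  · simp [stepExt, unitStep_eq_sub hab hs, Prod.map]
  · rw [mem_diamond, not_le] at hK
    simp only [stepExt, unitStep_eq_sub hab hs, StepSource]
    simpa using ⟨hK, hs, h.2⟩

theorem stepExt_mem_dom {p : ℂ × ℂ} (h : p ∈ Dom) (hK : p.1 ∉ diamond) : stepExt p ∈ Dom := by
  obtain ⟨a, b, hab, -, hs⟩ := exists_stepSource_stepExt h hK
  exact ⟨h.1.stepExt, (fiber_iff_source h.1.stepExt.1 h.1.stepExt.2).2 (Or.inr ⟨a, b, hab, hs⟩)⟩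

theorem stepExt_injOn {p q : ℂ × ℂ} (hp : p ∈ Dom) (hpK : p.1 ∉ diamond) (hq : q ∈ Dom)
    (hqK : q.1 ∉ diamond) (h : stepExt p = stepExt q) : p = q := by
  obtain ⟨a, b, hab, hpe, hs⟩ := exists_stepSource_stepExt hp hpK
  obtain ⟨a', b', hab', hqe, hs'⟩ := exists_stepSource_stepExt hq hqK
  rw [← h] at hqe hs'
  obtain ⟨rfl, rfl⟩ := stepSource_unique hp.1.stepExt.1 hp.1.stepExt.2 hab hab' hs hs'
  rw [hpe, hqe]

theorem invExt_ne_stepExt {p q : ℂ × ℂ} (hp : p ∈ Dom) (hpK : p.1 ∈ diamond) (hq : q ∈ Dom)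
    (hqK : q.1 ∉ diamond) : invExt p ≠ stepExt q := by
  intro h
  obtain ⟨a, b, hab, -, hs⟩ := exists_stepSource_stepExt hq hqK
  have hi := (invSource_invExt hp.1).2 ⟨hpK, hp.2⟩
  rw [h] at hi
  exact not_invSource_and_stepSource hq.1.stepExt.1 hq.1.stepExt.2 hab ⟨hi, hs⟩

theorem exists_source {p : ℂ × ℂ} (hp : p ∈ Dom) :
    (∃ q ∈ Dom, q.1 ∈ diamond ∧ invExt q = p) ∨ ∃ q ∈ Dom, q.1 ∉ diamond ∧ stepExt q = p := by
  rcases (fiber_iff_source hp.1.1 hp.1.2).1 hp.2 with h | ⟨a, b, hab, h1, h2, h3⟩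
  · left
    have := invSource_invExt hp.1.invExt
    rw [invExt_invExt] at this
    obtain ⟨h1, h2⟩ := this.1 h
    exact ⟨invExt p, ⟨hp.1.invExt, h2⟩, h1, invExt_invExt⟩
  · right
    set e : ℂ := a + b * Complex.I with he
    have hre : ∀ z : ℂ, (z + e).re = z.re + a := fun z => by simp [he]
    have him : ∀ z : ℂ, (z + e).im = z.im + b := fun z => by simp [he]
    refine ⟨(p.1 + e, p.2 + e), ⟨⟨?_, ?_⟩, ?_⟩, ?_, ?_⟩
    · simp only [hre, him]
      exact hp.1.1.add a b
    · simp only [hre, him]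
      exact hp.1.2.add a b
    · simpa only [hre, him] using h3
    · rw [mem_diamond, not_le]
      simpa only [hre, him] using h1
    · have := unitStep_eq_sub (z := p.1 + e) hab (by simpa only [hre, him] using h2)
      rw [← he] at this
      simp [stepExt, this]

/-! ### Finiteness of orbits and the first return map -/

/-- The reduction step lowers `|x| + |y|` by one, until the diamond
is reached; it lowers the second coordinate, seen from the same quadrant, by one as well. -/
theorem quadrant_step {p : ℂ × ℂ} (h : GenericPair p) (hK : (stepExt p).1 ∉ diamond) :
    |(stepExt p).1.re| + |(stepExt p).1.im| = |p.1.re| + |p.1.im| - 1 ∧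
    sgn (stepExt p).1.re * (stepExt p).2.re + sgn (stepExt p).1.im * (stepExt p).2.im =
      sgn p.1.re * p.2.re + sgn p.1.im * p.2.im - 1 := by
  obtain ⟨a, b, hab, hs⟩ := exists_unitPair h.1.abs_ne
  rw [mem_diamond, not_le] at hK
  simp only [stepExt, unitStep_eq_sub hab hs] at hK ⊢
  obtain ⟨h1, h2⟩ := abs_lt.1 hs
  rcases hab with ⟨rfl, rfl⟩ | ⟨rfl, rfl⟩ | ⟨rfl, rfl⟩ | ⟨rfl, rfl⟩ <;> simp at hK h1 h2 ⊢
  · have hy : |p.1.im| < p.1.re := abs_lt.2 ⟨by linarith, h2⟩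
    -- For `x ≤ 1` the target would satisfy `|x - 1| + |y| = 1 - x + |y| < 1` and lie in the
    -- diamond. So the moved coordinate keeps its sign; the other three units are analogous.
    have hx : 1 < p.1.re := by
      by_contra hc
      rw [abs_of_nonpos (by linarith)] at hK
      linarith
    rw [abs_of_pos (by linarith), abs_of_pos (show 0 < p.1.re by linarith),
      sgn_of_pos (by linarith), sgn_of_pos (show 0 < p.1.re by linarith)]
    constructor <;> ring
  · have hy : |p.1.im| < -p.1.re := abs_lt.2 ⟨by linarith, by linarith⟩
    have hx : p.1.re < -1 := by
      by_contra hc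
      rw [abs_of_nonneg (by linarith)] at hK
      linarith
    rw [abs_of_neg (by linarith), abs_of_neg (show p.1.re < 0 by linarith),
      sgn_of_neg (by linarith), sgn_of_neg (show p.1.re < 0 by linarith)]
    constructor <;> ring
  · have hy : |p.1.re| < p.1.im := abs_lt.2 ⟨by linarith, by linarith⟩
    have hx : 1 < p.1.im := by
      by_contra hc
      rw [abs_of_nonpos (show p.1.im - 1 ≤ 0 by linarith)] at hK
      linarith
    rw [abs_of_pos (show 0 < p.1.im - 1 by linarith), abs_of_pos (show 0 < p.1.im by linarith),
      sgn_of_pos (show 0 < p.1.im - 1 by linarith), sgn_of_pos (show 0 < p.1.im by linarith)]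
    constructor <;> ring
  · have hy : |p.1.re| < -p.1.im := abs_lt.2 ⟨by linarith, by linarith⟩
    have hx : p.1.im < -1 := by
      by_contra hc
      rw [abs_of_nonneg (show 0 ≤ p.1.im + 1 by linarith)] at hK
      linarith
    rw [abs_of_neg (show p.1.im + 1 < 0 by linarith), abs_of_neg (show p.1.im < 0 by linarith),
      sgn_of_neg (show p.1.im + 1 < 0 by linarith), sgn_of_neg (show p.1.im < 0 by linarith)]
    constructor <;> ring

/-- Outside the diamond both second coordinates, reflected into the octant, are below `1/2`. -/
theorem fiber_bound {x y u v : ℝ} (h : Fiber x y u v) (hK : 1 < |x| + |y|) :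
    sgn x * u + sgn y * v < 1 := by
  unfold Fiber OctantFiber at h
  split_ifs at h
  · linarith [h.1, (h.2.2 hK).1]
  · rw [add_comm |x|] at hK
    linarith [h.1, (h.2.2 hK).1]

theorem stepExt_iterate (n : ℕ) (p : ℂ × ℂ) :
    stepExt^[n] p = (unitStep^[n] p.1, p.2 - (p.1 - unitStep^[n] p.1)) := by
  induction n with
  | zero => simp
  | succ n ih =>
    rw [Function.iterate_succ_apply', Function.iterate_succ_apply', ih]
    simp only [stepExt, Prod.mk.injEq, true_and]
    ring

theorem exists_unitStep_iterate_mem {p : ℂ × ℂ} (h : GenericPair p) :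
    ∃ n, unitStep^[n] p.1 ∈ diamond := by
  obtain ⟨N, hN⟩ := exists_nat_ge (|p.1.re| + |p.1.im|)
  induction N generalizing p with
  | zero => exact ⟨0, hN.trans (by simp)⟩
  | succ N ih =>
    by_cases hK : (stepExt p).1 ∈ diamond
    · exact ⟨1, hK⟩
    · obtain ⟨n, hn⟩ := ih h.stepExt (by
        rw [(quadrant_step h hK).1]
        push_cast at hN
        linarith)
      exact ⟨n + 1, hn⟩

theorem diamondChoice_eq (z : ℂ) :
    diamondChoice z = z - unitStep^[stepCount diamond z] z := by
  unfold diamondChoice choiceOf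
  split_ifs with h
  · have : stepCount diamond z = 0 := Nat.sInf_eq_zero.2 (Or.inl h)
    simp [this]
  · rfl

theorem natExt_incl {p : ℂ × ℂ} (h : p.2 ≠ 0) :
    natExt (incl p) = incl (stepExt^[stepCount diamond (-1 / p.1)] (invExt p)) := by
  rw [stepExt_iterate]
  have h1 : sphereS ((p.2 : ℂ) : OnePoint ℂ) = ((-1 / p.2 : ℂ) : OnePoint ℂ) := if_neg h
  simp only [natExt, incl, invExt, h1, diamondChoice_eq, sphereT, OnePoint.map_some, sub_sub_cancel,
    ← sub_eq_add_neg]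

/-- The orbit of `p` under the reduction step enters the diamond at time `n` for the first time. -/
def EntersAt (p : ℂ × ℂ) (n : ℕ) : Prop :=
  (stepExt^[n] p).1 ∈ diamond ∧ ∀ k < n, (stepExt^[k] p).1 ∉ diamond

theorem entersAt_iff {p : ℂ × ℂ} {n : ℕ} (h : GenericPair p) :
    EntersAt p n ↔ n = stepCount diamond p.1 := by
  have he := exists_unitStep_iterate_mem h
  simp only [EntersAt, stepExt_iterate]
  have hmem : unitStep^[stepCount diamond p.1] p.1 ∈ diamond := Nat.sInf_mem he
  constructor
  · rintro ⟨h1, h2⟩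
    refine le_antisymm ?_ (Nat.sInf_le h1)
    by_contra hc
    exact h2 _ (not_le.1 hc) hmem
  · rintro rfl
    exact ⟨hmem, fun k hk => Nat.notMem_of_lt_sInf hk⟩

theorem stepExt_iterate_mem_dom {p : ℂ × ℂ} (h : p ∈ Dom) (n : ℕ)
    (hn : ∀ k < n, (stepExt^[k] p).1 ∉ diamond) : stepExt^[n] p ∈ Dom := by
  induction n with
  | zero => exact h
  | succ n ih =>
    rw [Function.iterate_succ_apply']
    exact stepExt_mem_dom (ih fun k hk => hn k (by omega)) (hn n (by omega))

/-- Steps are cancelled from the end on both sides. An inversion and a step never share a target, so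
the two step counts run out together. -/
theorem iterate_injective {p q : ℂ × ℂ} (hp : p ∈ Dom) (hpK : p.1 ∈ diamond) (hq : q ∈ Dom)
    (hqK : q.1 ∈ diamond) (n m : ℕ) (hn : ∀ k < n, (stepExt^[k] (invExt p)).1 ∉ diamond)
    (hm : ∀ k < m, (stepExt^[k] (invExt q)).1 ∉ diamond)
    (h : stepExt^[n] (invExt p) = stepExt^[m] (invExt q)) : p = q := by
  induction n generalizing m with
  | zero =>
    cases m with
    | zero => rw [← invExt_invExt (p := p), ← invExt_invExt (p := q)]; exact congrArg invExt h
    | succ m =>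
      rw [Function.iterate_succ_apply'] at h
      exact (invExt_ne_stepExt hp hpK (stepExt_iterate_mem_dom (invExt_mem_dom hq hqK) m
        fun k hk => hm k (by omega)) (hm m (by omega)) h).elim
  | succ n ih =>
    have hpn := stepExt_iterate_mem_dom (invExt_mem_dom hp hpK) n fun k hk => hn k (by omega)
    rw [Function.iterate_succ_apply'] at h
    cases m with
    | zero => exact (invExt_ne_stepExt hq hqK hpn (hn n (by omega)) h.symm).elim
    | succ m =>
      rw [Function.iterate_succ_apply'] at h
      exact ih m (fun k hk => hn k (by omega)) (fun k hk => hm k (by omega))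
        (stepExt_injOn hpn (hn n (by omega)) (stepExt_iterate_mem_dom (invExt_mem_dom hq hqK) m
          fun k hk => hm k (by omega)) (hm m (by omega)) h)

/-- Sources are followed backwards. Each backward step lowers `1 - (sgn x * u + sgn y * v)` by one,
while `fiber_bound` keeps it positive, so the search ends at an inversion. -/
theorem exists_iterate_eq {r : ℂ × ℂ} (hr : r ∈ Dom) (hrK : r.1 ∉ diamond) :
    ∃ p ∈ Dom, p.1 ∈ diamond ∧ ∃ n, stepExt^[n] (invExt p) = r ∧
      ∀ k < n, (stepExt^[k] (invExt p)).1 ∉ diamond := by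
  obtain ⟨N, hN⟩ := exists_nat_ge (1 - (sgn r.1.re * r.2.re + sgn r.1.im * r.2.im))
  induction N generalizing r with
  | zero =>
    rw [mem_diamond, not_le] at hrK
    have := fiber_bound hr.2 hrK
    push_cast at hN
    linarith
  | succ N ih =>
    rcases exists_source hr with ⟨q, hq, hqK, rfl⟩ | ⟨q, hq, hqK, rfl⟩
    · exact ⟨q, hq, hqK, 0, rfl, by simp⟩
    · obtain ⟨p, hp, hpK, n, rfl, hn⟩ := ih hq hqK (by
        have := (quadrant_step hq.1 hrK).2
        push_cast at hN
        linarith)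
      refine ⟨p, hp, hpK, n + 1, Function.iterate_succ_apply' _ _ _, fun k hk => ?_⟩
      rcases Nat.lt_succ_iff_lt_or_eq.1 hk with hk | rfl
      · exact hn k hk
      · exact hqK

theorem natExt_bijOn :
    BijOn natExt (incl '' {p ∈ Dom | p.1 ∈ diamond}) (incl '' {p ∈ Dom | p.1 ∈ diamond}) := by
  have hne : ∀ {p : ℂ × ℂ}, p ∈ Dom → p.2 ≠ 0 := fun {p} hp h0 =>
    hp.1.2.left_ne (by simp [h0])
  have hincl : Function.Injective incl := measurableEmbedding_incl.injective
  have hent : ∀ {p : ℂ × ℂ}, p ∈ Dom → EntersAt (invExt p) (stepCount diamond (-1 / p.1)) :=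
    fun hp => (entersAt_iff hp.1.invExt).2 rfl
  refine ⟨?_, ?_, ?_⟩
  · rintro _ ⟨p, ⟨hp, hpK⟩, rfl⟩
    rw [natExt_incl (hne hp)]
    obtain ⟨h1, h2⟩ := hent hp
    exact mem_image_of_mem _ ⟨stepExt_iterate_mem_dom (invExt_mem_dom hp hpK) _ h2, h1⟩
  · rintro _ ⟨p, ⟨hp, hpK⟩, rfl⟩ _ ⟨q, ⟨hq, hqK⟩, rfl⟩ h
    rw [natExt_incl (hne hp), natExt_incl (hne hq)] at h
    rw [iterate_injective hp hpK hq hqK _ _ (hent hp).2 (hent hq).2 (hincl h)]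
  · rintro _ ⟨r, ⟨hr, hrK⟩, rfl⟩
    -- Inverting a point of the diamond leaves the diamond, so the last move into `r` is a step;
    -- this accounts for the count `n + 1`.
    rcases exists_source hr with ⟨q, hq, hqK, rfl⟩ | ⟨q, hq, hqK, rfl⟩
    · exact (invExt_notMem_diamond hq.1 hqK hrK).elim
    · obtain ⟨p, hp, hpK, n, rfl, hn⟩ := exists_iterate_eq hq hqK
      refine ⟨incl p, mem_image_of_mem _ ⟨hp, hpK⟩, ?_⟩
      have : EntersAt (invExt p) (n + 1) := by
        refine ⟨by rwa [Function.iterate_succ_apply'], fun k hk => ?_⟩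
        rcases Nat.lt_succ_iff_lt_or_eq.1 hk with hk | rfl
        · exact hn k hk
        · exact hqK
      have e : n + 1 = stepCount diamond (-1 / p.1) := (entersAt_iff hp.1.invExt).1 this
      rw [natExt_incl (hne hp), ← e, Function.iterate_succ_apply']

/-! ### Comparison with the pieces `K i ×ˢ L i` -/

/-- `⋃ K_i × L_i`, the union being over `1 ≤ i ≤ 3`, in Cartesian coordinates. -/
def BasePiece (x y u v : ℝ) : Prop :=
  |x| + |y| ≤ 1 ∧
  ((x ^ 2 + y ^ 2 + x + y ≤ 0 ∧ x ^ 2 + y ^ 2 + x - y ≤ 0 ∧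
      2 * v ≤ u ^ 2 + v ^ 2 ∧ 1 ≤ u ^ 2 + v ^ 2 ∧ -(2 * v) ≤ u ^ 2 + v ^ 2 ∧ -(1 / 2) ≤ u) ∨
    (0 ≤ x ^ 2 + y ^ 2 + x + y ∧ 0 ≤ y ∧ y ≤ -x ∧
      2 * v ≤ u ^ 2 + v ^ 2 ∧ 1 ≤ u ^ 2 + v ^ 2 ∧ -(1 / 2) ≤ u) ∨
    (0 ≤ x ^ 2 + y ^ 2 - x - y ∧ -y ≤ x ∧ x ≤ 0 ∧
      -(2 * u) ≤ u ^ 2 + v ^ 2 ∧ 1 ≤ u ^ 2 + v ^ 2 ∧ v ≤ 1 / 2))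

theorem norm_sub_le_iff (z c : ℂ) (r : ℝ) (hr : 0 ≤ r) :
    ‖z - c‖ ≤ r ↔ (z.re - c.re) ^ 2 + (z.im - c.im) ^ 2 ≤ r ^ 2 := by
  rw [← sq_le_sq₀ (norm_nonneg _) hr, Complex.sq_norm, Complex.normSq_apply]
  simp [sq]

theorem le_norm_sub_iff (z c : ℂ) (r : ℝ) (hr : 0 ≤ r) :
    r ≤ ‖z - c‖ ↔ r ^ 2 ≤ (z.re - c.re) ^ 2 + (z.im - c.im) ^ 2 := by
  rw [← sq_le_sq₀ hr (norm_nonneg _), Complex.sq_norm, Complex.normSq_apply]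
  simp [sq]

theorem mem_K_one {z : ℂ} : z ∈ K 1 ↔ z ∈ diamond ∧
    z.re ^ 2 + z.im ^ 2 + z.re + z.im ≤ 0 ∧ z.re ^ 2 + z.im ^ 2 + z.re - z.im ≤ 0 := by
  simp only [K, mem_ofPred_eq]
  rw [norm_sub_le_iff _ _ _ (by positivity), norm_sub_le_iff _ _ _ (by positivity)]
  simp
  intro _
  constructor <;> rintro ⟨h1, h2⟩ <;> constructor <;> linarith

theorem mem_K_two {z : ℂ} : z ∈ K 2 ↔ z ∈ diamond ∧
    0 ≤ z.re ^ 2 + z.im ^ 2 + z.re + z.im ∧ 0 ≤ z.im ∧ z.im ≤ -z.re := by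
  simp only [K, mem_ofPred_eq]
  rw [le_norm_sub_iff _ _ _ (by positivity)]
  simp
  intro _ _ _
  constructor <;> intro h1 <;> linarith

theorem mem_K_three {z : ℂ} : z ∈ K 3 ↔ z ∈ diamond ∧
    0 ≤ z.re ^ 2 + z.im ^ 2 - z.re - z.im ∧ -z.im ≤ z.re ∧ z.re ≤ 0 := by
  simp only [K, mem_ofPred_eq]
  rw [le_norm_sub_iff _ _ _ (by positivity)]
  simp
  intro _ _ _
  constructor <;> intro h1 <;> linarith

theorem coe_mem_univ_diff {s : Set ℂ} {w : ℂ} :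
    (w : OnePoint ℂ) ∈ univ \ ((↑) '' s : Set (OnePoint ℂ)) ↔ w ∉ s := by
  simp [OnePoint.coe_injective.mem_set_image]

theorem notMem_ball_iff {w c : ℂ} :
    w ∉ Metric.ball c 1 ↔ 1 ≤ (w.re - c.re) ^ 2 + (w.im - c.im) ^ 2 := by
  rw [Metric.mem_ball, not_lt, dist_eq_norm, le_norm_sub_iff _ _ _ zero_le_one, one_pow]

theorem coe_mem_L_one {w : ℂ} : (w : OnePoint ℂ) ∈ L 1 ↔
    2 * w.im ≤ w.re ^ 2 + w.im ^ 2 ∧ 1 ≤ w.re ^ 2 + w.im ^ 2 ∧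
      -(2 * w.im) ≤ w.re ^ 2 + w.im ^ 2 ∧ -(1 / 2) ≤ w.re := by
  rw [L, coe_mem_univ_diff]
  simp only [mem_union, not_or, notMem_ball_iff, mem_ofPred_eq, not_lt]
  simp
  constructor
  · rintro ⟨⟨⟨h1, h2⟩, h3⟩, h4⟩; refine ⟨?_, ?_, ?_, ?_⟩ <;> linarith
  · rintro ⟨h1, h2, h3, h4⟩; refine ⟨⟨⟨?_, ?_⟩, ?_⟩, ?_⟩ <;> linarith

theorem coe_mem_L_two {w : ℂ} : (w : OnePoint ℂ) ∈ L 2 ↔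
    2 * w.im ≤ w.re ^ 2 + w.im ^ 2 ∧ 1 ≤ w.re ^ 2 + w.im ^ 2 ∧ -(1 / 2) ≤ w.re := by
  rw [L, coe_mem_univ_diff]
  simp only [mem_union, not_or, notMem_ball_iff, mem_ofPred_eq, not_lt]
  simp
  constructor
  · rintro ⟨⟨h1, h2⟩, h3⟩; refine ⟨?_, ?_, ?_⟩ <;> linarith
  · rintro ⟨h1, h2, h3⟩; refine ⟨⟨?_, ?_⟩, ?_⟩ <;> linarith

theorem coe_mem_L_three {w : ℂ} : (w : OnePoint ℂ) ∈ L 3 ↔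
    -(2 * w.re) ≤ w.re ^ 2 + w.im ^ 2 ∧ 1 ≤ w.re ^ 2 + w.im ^ 2 ∧ w.im ≤ 1 / 2 := by
  rw [L, coe_mem_univ_diff]
  simp only [mem_union, not_or, notMem_ball_iff, mem_ofPred_eq, not_lt]
  simp
  constructor
  · rintro ⟨⟨h1, h2⟩, h3⟩; refine ⟨?_, ?_, ?_⟩ <;> linarith
  · rintro ⟨h1, h2, h3⟩; refine ⟨⟨?_, ?_⟩, ?_⟩ <;> linarith

theorem mem_K_add_four {i : ℕ} {z : ℂ} : z ∈ K (i + 4) ↔ Complex.I * z ∈ K (i + 1) := by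
  rw [K]
  constructor
  · rintro ⟨z, hz, rfl⟩
    simpa [← mul_assoc] using hz
  · intro h
    exact ⟨_, h, by simp [← mul_assoc]⟩

theorem coe_mem_L_add_four {i : ℕ} {w : ℂ} :
    (w : OnePoint ℂ) ∈ L (i + 4) ↔ ((Complex.I * w : ℂ) : OnePoint ℂ) ∈ L (i + 1) := by
  rw [L]
  constructor
  · rintro ⟨_ | w', hw', h⟩
    · exact (OnePoint.infty_ne_coe _ h).elim
    · have : -Complex.I * w' = w := OnePoint.coe_injective h
      have e : Complex.I * (-Complex.I * w') = w' := by simp [← mul_assoc]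
      rw [← this, e]
      exact hw'
  · intro h
    exact ⟨_, h, by simp [← mul_assoc]⟩

theorem basePiece_iff {z w : ℂ} : BasePiece z.re z.im w.re w.im ↔
    z ∈ K 1 ∧ (w : OnePoint ℂ) ∈ L 1 ∨ z ∈ K 2 ∧ (w : OnePoint ℂ) ∈ L 2 ∨
      z ∈ K 3 ∧ (w : OnePoint ℂ) ∈ L 3 := by
  rw [mem_K_one, mem_K_two, mem_K_three, coe_mem_L_one, coe_mem_L_two, coe_mem_L_three,
    BasePiece, mem_diamond]
  tauto

theorem incl_mem_omega {p : ℂ × ℂ} : incl p ∈ Omega ↔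
    BasePiece p.1.re p.1.im p.2.re p.2.im ∨
    BasePiece (-p.1.im) p.1.re (-p.2.im) p.2.re ∨
    BasePiece (-p.1.re) (-p.1.im) (-p.2.re) (-p.2.im) ∨
    BasePiece p.1.im (-p.1.re) p.2.im (-p.2.re) := by
  have h0 := basePiece_iff (z := p.1) (w := p.2)
  have h1 := basePiece_iff (z := Complex.I * p.1) (w := Complex.I * p.2)
  have h2 := basePiece_iff (z := Complex.I * (Complex.I * p.1))
    (w := Complex.I * (Complex.I * p.2))
  have h3 := basePiece_iff (z := Complex.I * (Complex.I * (Complex.I * p.1)))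
    (w := Complex.I * (Complex.I * (Complex.I * p.2)))
  simp only [Complex.I_mul_re, Complex.I_mul_im, neg_neg] at h1 h2 h3
  rw [h0, h1, h2, h3]
  have key : incl p ∈ Omega ↔ ∃ i ∈ Finset.Icc 1 12, p.1 ∈ K i ∧ (p.2 : OnePoint ℂ) ∈ L i := by
    simp only [Omega, incl, mem_iUnion, mem_prod, exists_prop]
  have hK : ∀ i z, z ∈ K (i + 4) ↔ Complex.I * z ∈ K (i + 1) := fun _ _ => mem_K_add_four
  have hL : ∀ i (w : ℂ), (w : OnePoint ℂ) ∈ L (i + 4) ↔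
      ((Complex.I * w : ℂ) : OnePoint ℂ) ∈ L (i + 1) := fun _ _ => coe_mem_L_add_four
  -- Indices are written as `i + 4` to match the recursion; unwinding it up to three times leaves
  -- four rotations of the three base pieces.
  have eI : Finset.Icc 1 12 = {1, 2, 3, 0 + 4, 1 + 4, 2 + 4, 3 + 4, 4 + 4, 5 + 4, 6 + 4, 7 + 4,
    8 + 4} := by decide
  rw [key, eI]
  simp only [Finset.mem_insert, Finset.mem_singleton, exists_eq_or_imp, exists_eq_left]
  rw [hK 0, hK 1, hK 2, hK 3, hK 4, hK 5, hK 6, hK 7, hK 8, hL 0, hL 1, hL 2, hL 3, hL 4, hL 5,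
    hL 6, hL 7, hL 8]
  rw [show 3 + 1 = 0 + 4 from rfl, show 4 + 1 = 1 + 4 from rfl, show 5 + 1 = 2 + 4 from rfl,
    show 6 + 1 = 3 + 4 from rfl, show 7 + 1 = 4 + 4 from rfl, show 8 + 1 = 5 + 4 from rfl,
    hK 0, hK 1, hK 2, hK 3, hK 4, hK 5, hL 0, hL 1, hL 2, hL 3, hL 4, hL 5,
    show 3 + 1 = 0 + 4 from rfl, show 4 + 1 = 1 + 4 from rfl, show 5 + 1 = 2 + 4 from rfl,
    hK 0, hK 1, hK 2, hL 0, hL 1, hL 2]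
  simp only [zero_add, Nat.reduceAdd, or_assoc]

theorem fiber_of_basePiece {x y u v : ℝ} (hz : Generic x y) (hw : Generic u v)
    (h : BasePiece x y u v) : Fiber x y u v := by
  obtain ⟨h1, h⟩ := h
  have h1 := lt_of_le_of_ne h1 hz.abs_add_abs_ne_one
  have hx := hz.left_ne
  have hy := hz.right_ne
  have hxy := hz.abs_ne
  have hn := hz.normSq_pos
  have w1 : u ^ 2 + v ^ 2 ≠ 1 := fun e => (hw.ne 1 0 0 (-1)) (by norm_num; linarith)
  have w2 : u ^ 2 + v ^ 2 ≠ 2 * v := fun e => (hw.ne 1 0 (-2) 0) (by norm_num; linarith)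
  have w3 : u ^ 2 + v ^ 2 ≠ -(2 * v) := fun e => (hw.ne 1 0 2 0) (by norm_num; linarith)
  have w4 : u ^ 2 + v ^ 2 ≠ -(2 * u) := fun e => (hw.ne 1 2 0 0) (by norm_num; linarith)
  have w5 : u ≠ -(1 / 2) := fun e => (hw.ne 0 2 0 1) (by norm_num; linarith)
  have w6 : v ≠ 1 / 2 := fun e => (hw.ne 0 0 2 (-1)) (by norm_num; linarith)
  rcases h with ⟨a1, a2, b1, b2, b3, b4⟩ | ⟨a1, a2, a3, b1, b2, b3⟩ | ⟨a1, a2, a3, b1, b2, b3⟩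
  · have c1 := lt_of_le_of_ne b1 w2.symm
    have c2 := lt_of_le_of_ne b2 w1.symm
    have c3 := lt_of_le_of_ne b3 w3.symm
    have c4 := lt_of_le_of_ne b4 w5.symm
    -- Adding the two disk conditions gives `x ^ 2 + y ^ 2 + x ≤ 0`. This lens straddles the real
    -- axis, so both signs of `y` occur.
    have hx0 : x < 0 := by linarith
    rcases hy.lt_or_gt with hy | hy
    · rw [abs_of_neg hx0, abs_of_neg hy] at h1
      rw [← fiber_neg hx, ← fiber_neg_right hy.ne, fiber_octant (by linarith) (by linarith)]
      refine ⟨by linarith, fun _ => ⟨by linarith, by linarith, fun _ => by linarith⟩,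
        fun h => by linarith⟩
    · rw [abs_of_neg hx0, abs_of_pos hy] at h1
      rw [← fiber_neg hx, fiber_octant (by linarith) (by linarith)]
      refine ⟨by linarith, fun _ => ⟨by linarith, by linarith, fun _ => by linarith⟩,
        fun h => by linarith⟩
  · have hy0 := lt_of_le_of_ne a2 hy.symm
    have c1 := lt_of_le_of_ne b1 w2.symm
    have c2 := lt_of_le_of_ne b2 w1.symm
    have c3 := lt_of_le_of_ne b3 w5.symm
    have hx0 : x < 0 := by linarith
    rw [abs_of_neg hx0, abs_of_pos hy0] at h1 hxy
    rw [← fiber_neg hx, fiber_octant hy0 (lt_of_le_of_ne a3 hxy.symm)]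
    refine ⟨by linarith, fun _ => ⟨by linarith, by linarith, fun _ => by linarith⟩,
      fun h => by linarith⟩
  · have hx0 := lt_of_le_of_ne a3 hx
    have c1 := lt_of_le_of_ne b1 w4.symm
    have c2 := lt_of_le_of_ne b2 w1.symm
    have c3 := lt_of_le_of_ne b3 w6
    have hy0 : 0 < y := by linarith
    rw [abs_of_neg hx0, abs_of_pos hy0] at h1 hxy
    have hyx : -x < y := lt_of_le_of_ne (by linarith) hxy
    rw [← fiber_neg hx, ← fiber_swap (by rw [abs_neg]; exact hz.abs_ne),
      fiber_octant (by linarith) hyx]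
    refine ⟨by linarith, fun _ => ⟨by linarith, by linarith, fun _ => by linarith⟩,
      fun h => by linarith⟩

/-- The second quadrant of the diamond is covered by `K 1`, `K 2`, `K 3` and `K 4`; the rotated
alternative is needed for the lens `K 4`. -/
theorem basePiece_of_fiber {x y u v : ℝ} (hz : Generic x y) (h1 : |x| + |y| ≤ 1)
    (hx : x < 0) (hy : 0 < y) (h : Fiber x y u v) :
    BasePiece x y u v ∨ BasePiece (-y) x (-v) u := by
  have h1' := h1
  have h1 := lt_of_le_of_ne h1 hz.abs_add_abs_ne_one
  have hxy := hz.abs_ne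
  unfold BasePiece
  rw [abs_neg, add_comm |y|]
  simp only [h1', true_and]
  rw [abs_of_neg hx, abs_of_pos hy] at h1 hxy
  rw [← fiber_neg hx.ne] at h
  -- Together these say that this quadrant of the diamond lies in the disk about `(-1 + i) / 2`, so
  -- one of the two disk conditions of each lens is automatic.
  have hx2 : x ^ 2 ≤ -x := by nlinarith
  have hy2 : y ^ 2 ≤ y := by nlinarith
  rcases hxy.lt_or_gt with hc | hc
  · rw [← fiber_swap (by rw [abs_neg]; exact hz.abs_ne), fiber_octant (by linarith) hc] at h
    obtain ⟨a1, a2, -⟩ := h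
    obtain ⟨a2, a3, a4⟩ := a2 (by linarith)
    by_cases hd : x ^ 2 + y ^ 2 - x - y < 0
    · have := a4 (by linarith)
      exact Or.inr (Or.inl ⟨by linarith, by linarith, by linarith, by linarith, by linarith,
        by linarith⟩)
    · exact Or.inl (Or.inr (Or.inr ⟨by linarith, by linarith, by linarith, by linarith,
        by linarith, by linarith⟩))
  · rw [fiber_octant hy hc] at h
    obtain ⟨a1, a2, -⟩ := h
    obtain ⟨a2, a3, a4⟩ := a2 (by linarith)
    left
    by_cases hd : x ^ 2 + y ^ 2 + x + y < 0
    · have := a4 (by linarith)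
      exact Or.inl ⟨by linarith, by linarith, by linarith, by linarith, by linarith, by linarith⟩
    · exact Or.inr (Or.inl ⟨by linarith, by linarith, by linarith, by linarith, by linarith,
        by linarith⟩)

theorem fiber_rotate {x y u v : ℝ} (hz : Generic x y) : Fiber (-y) x (-v) u ↔ Fiber x y u v := by
  rw [fiber_neg hz.right_ne, fiber_swap hz.abs_ne]

theorem incl_mem_omega_iff {p : ℂ × ℂ} (hp : GenericPair p) :
    incl p ∈ Omega ↔ p ∈ Dom ∧ p.1 ∈ diamond := by
  rw [incl_mem_omega, Dom, mem_ofPred_eq, mem_diamond]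
  obtain ⟨hz, hw⟩ := hp
  have r1 := fiber_rotate (u := p.2.re) (v := p.2.im) hz
  have hz1 := hz.swap.neg_left
  have r2 := fiber_rotate (u := -p.2.im) (v := p.2.re) hz1
  have hz2 := hz1.swap.neg_left
  have r3 := fiber_rotate (u := -p.2.re) (v := -p.2.im) hz2
  have hz3 := hz2.swap.neg_left
  have hw1 := hw.swap.neg_left
  have hw2 := hw1.swap.neg_left
  have hw3 := hw2.swap.neg_left
  rw [neg_neg] at r3 hz3 hw3
  rw [neg_neg] at r3
  constructor
  · rintro (h | h | h | h)
    · exact ⟨⟨⟨hz, hw⟩, fiber_of_basePiece hz hw h⟩, h.1⟩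
    · exact ⟨⟨⟨hz, hw⟩, r1.1 (fiber_of_basePiece hz1 hw1 h)⟩, by
        simpa [add_comm] using h.1⟩
    · exact ⟨⟨⟨hz, hw⟩, r1.1 (r2.1 (fiber_of_basePiece hz2 hw2 h))⟩, by simpa using h.1⟩
    · exact ⟨⟨⟨hz, hw⟩, r1.1 (r2.1 (r3.1 (fiber_of_basePiece hz3 hw3 h)))⟩, by
        simpa [add_comm] using h.1⟩
  · rintro ⟨⟨-, h⟩, hK⟩
    rcases hz.left_ne.lt_or_gt with hx | hx <;> rcases hz.right_ne.lt_or_gt with hy | hy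
    · have := basePiece_of_fiber hz3 (by simpa [add_comm] using hK) hy (by linarith)
        (r3.2 (r2.2 (r1.2 h)))
      rw [neg_neg, neg_neg] at this
      tauto
    · have := basePiece_of_fiber hz hK hx hy h
      tauto
    · have := basePiece_of_fiber hz2 (by simpa using hK) (by linarith) (by linarith)
        (r2.2 (r1.2 h))
      rw [neg_neg, neg_neg] at this
      tauto
    · have := basePiece_of_fiber hz1 (by simpa [add_comm] using hK) (by linarith) hx (r1.2 h)
      tauto

/-! ### Null sets and conclusion -/

theorem finite_quadratic {a q c : ℝ} (h : a ≠ 0 ∨ q ≠ 0) :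
    {y : ℝ | a * y ^ 2 + q * y + c = 0}.Finite := by
  have hP : (Polynomial.C a * Polynomial.X ^ 2 + Polynomial.C q * Polynomial.X +
      Polynomial.C c : Polynomial ℝ) ≠ 0 := by
    intro h0
    have h2 := congrArg (Polynomial.coeff · 2) h0
    have h1 := congrArg (Polynomial.coeff · 1) h0
    simp [Polynomial.coeff_C] at h1 h2
    tauto
  refine (Polynomial.finite_setOfPred_isRoot hP).subset fun y hy => ?_
  simpa [Polynomial.IsRoot] using hy

/-- By Fubini it suffices that almost every vertical slice is null. A slice is the zero set of a
quadratic in `y`, finite unless `a = q = 0`; in that case all but finitely many slices are empty. -/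
theorem volume_circle_eq_zero {a p q d : ℝ} (h : ¬ (a = 0 ∧ p = 0 ∧ q = 0 ∧ d = 0)) :
    volume {z : ℂ | a * (z.re ^ 2 + z.im ^ 2) + p * z.re + q * z.im + d = 0} = 0 := by
  set S : Set (ℝ × ℝ) := {z | a * (z.1 ^ 2 + z.2 ^ 2) + p * z.1 + q * z.2 + d = 0}
  have hS : MeasurableSet S := (isClosed_eq (by fun_prop) continuous_const).measurableSet
  have hpre : {z : ℂ | a * (z.re ^ 2 + z.im ^ 2) + p * z.re + q * z.im + d = 0} =
      Complex.measurableEquivRealProd ⁻¹' S := by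
    ext z
    simp [S, Complex.measurableEquivRealProd_apply]
  rw [hpre, Complex.volume_preserving_equiv_real_prod.measure_preimage hS.nullMeasurableSet,
    Measure.volume_eq_prod, Measure.measure_prod_null hS]
  by_cases haq : a = 0 ∧ q = 0
  · obtain ⟨rfl, rfl⟩ := haq
    have hfin : {x : ℝ | p * x + d = 0}.Finite := by
      by_cases hp : p = 0
      · have hd : d ≠ 0 := by tauto
        simp [hp, hd]
      · simpa using finite_quadratic (a := 0) (q := p) (c := d) (Or.inr hp)
    filter_upwards [compl_mem_ae_iff.2 (hfin.measure_zero volume)] with x hx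
    have : Prod.mk x ⁻¹' S = ∅ := by
      ext y
      simpa [S] using hx
    simp [this]
  · refine Filter.Eventually.of_forall fun x => ?_
    refine ((finite_quadratic (a := a) (q := q) (c := a * x ^ 2 + p * x + d) (by tauto)).subset
      fun y hy => ?_).measure_zero volume
    have hy : a * (x ^ 2 + y ^ 2) + p * x + q * y + d = 0 := hy
    show a * y ^ 2 + q * y + (a * x ^ 2 + p * x + d) = 0
    linarith

theorem volume_not_generic : volume {z : ℂ | ¬ Generic z.re z.im} = 0 := by
  refine measure_mono_null (t := ⋃ c : {c : ℤ × ℤ × ℤ × ℤ // c ≠ 0},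
    {z : ℂ | (c.1.1 : ℝ) * (z.re ^ 2 + z.im ^ 2) + (c.1.2.1 : ℝ) * z.re +
      (c.1.2.2.1 : ℝ) * z.im + (c.1.2.2.2 : ℝ) = 0}) ?_ (measure_iUnion_null fun c => ?_)
  · intro z hz
    simp only [Generic, mem_ofPred_eq, not_forall] at hz
    obtain ⟨a, p, q, d, h, h0⟩ := hz
    exact mem_iUnion.2 ⟨⟨(a, p, q, d), by simpa [Prod.ext_iff] using h0⟩, h⟩
  · refine volume_circle_eq_zero fun h => c.2 ?_
    simpa [Prod.ext_iff] using h

theorem volume_not_genericPair : volume {p : ℂ × ℂ | ¬ GenericPair p} = 0 := by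
  refine measure_mono_null (t := {z : ℂ | ¬ Generic z.re z.im} ×ˢ univ ∪
    univ ×ˢ {z : ℂ | ¬ Generic z.re z.im}) ?_ (measure_union_null ?_ ?_)
  · intro p hp
    simp only [GenericPair, mem_ofPred_eq, not_and_or] at hp
    simpa using hp
  · rw [Measure.volume_eq_prod, Measure.prod_prod, volume_not_generic, zero_mul]
  · rw [Measure.volume_eq_prod, Measure.prod_prod, volume_not_generic, mul_zero]

theorem bijectiveAEOn_natExt : BijectiveAEOn lebesgue natExt Omega := by
  have hsub : incl '' {p ∈ Dom | p.1 ∈ diamond} ⊆ Omega := by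
    rintro _ ⟨p, hp, rfl⟩
    exact (incl_mem_omega_iff hp.1.1).2 hp
  have hnull : lebesgue (Omega \ incl '' {p ∈ Dom | p.1 ∈ diamond}) = 0 := by
    rw [lebesgue_apply]
    refine measure_mono_null (t := {p : ℂ × ℂ | ¬ GenericPair p}) (fun p hp hg => hp.2 ?_)
      volume_not_genericPair
    exact mem_image_of_mem _ ((incl_mem_omega_iff hg).1 hp.1)
  exact ⟨_, _, hsub, hsub, hnull, hnull, natExt_bijOn⟩

end DiamondCF

end

theorem mainTheorem3 :
    DiamondCF.BijectiveAEOn DiamondCF.lebesgue DiamondCF.natExt DiamondCF.Omega :=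
  DiamondCF.bijectiveAEOn_natExt
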